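/- Theorem. The power graph $\mathcal{P}(G)$ of a group $G$ has vertex set $G$, two distinct elements being adjacent if one is a power of the other; the proper power graph $\mathcal{P}^*(G)$ is obtained from it by deleting the identity element. Let $p$ be an odd prime, let $n\ge 1$, let $\mathbb{F}_{p^n}$ be the field with $p^n$ elements, and let $G=PGL(2,p^n)=GL(2,\mathbb{F}_{p^n})/Z(GL(2,\mathbb{F}_{p^n}))$. Then the number of connected components of $\mathcal{P}^*(G)$ is equal to $(p^{2n+1}-1)/(p-1)$. -/

import Mathlib

open scoped MatrixGroups

/-- The power graph of a group `G`: the vertices are the elements of `G`, and two distinct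
elements are adjacent if one of them is a power of the other. -/
def powerGraph (G : Type*) [Group G] : SimpleGraph G where
  Adj x y := x ≠ y ∧ ((∃ k : ℤ, y = x ^ k) ∨ ∃ k : ℤ, x = y ^ k)
  symm := ⟨fun _ _ h => ⟨h.1.symm, h.2.symm⟩⟩
  loopless := ⟨fun _ h => h.1 rfl⟩

/-- The proper power graph of a group `G`: the power graph with the identity element removed. -/
def properPowerGraph (G : Type*) [Group G] : SimpleGraph {x : G // x ≠ 1} :=
  (powerGraph G).induce {x : G | x ≠ 1}

/-! Write q for the order of F. As 2 is invertible, a matrix is a scalar plus a traceless M, and M ≠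
0 when its class in PGL is nontrivial. The centralizer of M is then F[M], and its image in PGL is
closed under powers and under roots of nontrivial elements (`CommutesWith.of_zpow`), so no path
leaves it. M² is a scalar d. If d ≠ 0, this image is cyclic (`exists_generator_of_commutesWith`),
giving one component per line of such M: (q³ - q²)/(q - 1) = q² in all. If d = 0, the image is {1 +
cM}, a copy of (F, +), whose components are its subgroups of order p without the identity. Each
accounts for p - 1 of the q² - 1 nonzero nilpotent matrices, giving (q² - 1)/(p - 1). The sum is
(pq² - 1)/(p - 1). -/

open Matrix Matrix.ProjGenLinGroup

/-! ### Counting along maps with equinumerous fibres -/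

theorem Nat.card_eq_card_range_mul {α β U : Type*} [Finite α] (f : α → β)
    (h : ∀ a, ∃ e : U → α, Function.Injective e ∧ ∀ b, f b = f a ↔ b ∈ Set.range e) :
    Nat.card α = Nat.card (Set.range f) * Nat.card U := by
  have : Fintype (Set.range f) := Fintype.ofFinite _
  rw [Nat.card_congr (Equiv.sigmaFiberEquiv (Set.rangeFactorization f)).symm, Nat.card_sigma]
  have key : ∀ y : Set.range f,
      Nat.card {a // Set.rangeFactorization f a = y} = Nat.card U := by
    rintro ⟨_, a, rfl⟩
    obtain ⟨e, he, hr⟩ := h a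
    refine Nat.card_congr (Equiv.trans (Equiv.subtypeEquivRight fun b => ?_)
      (Equiv.ofInjective e he).symm)
    rw [← hr b]
    simp [Set.rangeFactorization, Subtype.ext_iff]
  simp [key]

theorem Nat.card_eq_card_range_add_card_range {α β γ : Type*} [Finite γ] (f : α → γ) (g : β → γ)
    (hfg : ∀ a b, f a ≠ g b) (hsurj : ∀ c, c ∈ Set.range f ∨ c ∈ Set.range g) :
    Nat.card γ = Nat.card (Set.range f) + Nat.card (Set.range g) := by
  have hc : IsCompl (Set.range f) (Set.range g) := by
    refine ⟨Set.disjoint_left.2 ?_, codisjoint_iff.2 (Set.eq_univ_of_forall hsurj)⟩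
    rintro _ ⟨a, rfl⟩ ⟨b, hb⟩
    exact hfg a b hb.symm
  rw [Nat.card_coe_set_eq, Nat.card_coe_set_eq, ← hc.compl_eq, Set.ncard_add_ncard_compl]

/-! ### Connectivity in the proper power graph -/

section PowerGraph

variable {G : Type*} [Group G]

theorem properPowerGraph_reachable_zpow {x y : {x : G // x ≠ 1}} {k : ℤ}
    (h : (y : G) = (x : G) ^ k) : (properPowerGraph G).Reachable x y := by
  by_cases hxy : x = y
  · rw [hxy]
  · exact SimpleGraph.Adj.reachable ⟨fun h => hxy (Subtype.ext h), Or.inl ⟨k, h⟩⟩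

theorem properPowerGraph_reachable_of_zpow_of_zpow {g : G} {x y : {x : G // x ≠ 1}} {k l : ℤ}
    (hx : (x : G) = g ^ k) (hy : (y : G) = g ^ l) : (properPowerGraph G).Reachable x y := by
  have hg : g ≠ 1 := by
    rintro rfl
    exact x.2 (by simpa using hx)
  exact (properPowerGraph_reachable_zpow (x := ⟨g, hg⟩) hx).symm.trans
    (properPowerGraph_reachable_zpow (x := ⟨g, hg⟩) hy)

/-- Crossing an edge means taking a power or a root. The condition `x ^ k ≠ 1` is available because
the identity is not a vertex. -/
theorem SimpleGraph.Reachable.properPowerGraph_induction {P : G → Prop}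
    (hpow : ∀ x (k : ℤ), x ^ k ≠ 1 → P x → P (x ^ k))
    (hroot : ∀ x (k : ℤ), x ^ k ≠ 1 → P (x ^ k) → P x)
    {x y : {x : G // x ≠ 1}} (h : (properPowerGraph G).Reachable x y) (hx : P x) : P y := by
  obtain ⟨w⟩ := h
  induction w with
  | nil => exact hx
  | @cons u v _ huv _ ih =>
    apply ih
    obtain ⟨-, ⟨k, hk⟩ | ⟨k, hk⟩⟩ := huv
    · replace hk : (v : G) = (u : G) ^ k := hk
      rw [hk]
      exact hpow _ _ (hk ▸ v.2) hx
    · replace hk : (u : G) = (v : G) ^ k := hk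
      rw [hk] at hx
      exact hroot _ _ (hk ▸ u.2) hx

end PowerGraph

/-! ### Two by two matrices -/

section Matrices

variable {F : Type*} [Field F]

theorem Matrix.exists_eq_smul_one_add_smul_of_commute {A B : Matrix (Fin 2) (Fin 2) F}
    (hA : ∀ a : F, A ≠ a • 1) (h : Commute B A) : ∃ a b : F, B = a • 1 + b • A := by
  have h' := h.eq
  rw [← Matrix.ext_iff] at h'
  simp only [Fin.forall_fin_two, Matrix.mul_apply, Fin.sum_univ_two] at h'
  obtain ⟨⟨h1, h2⟩, h3, h4⟩ := h'
  -- As A is not scalar, one of `A 0 1`, `A 1 0`, `A 0 0 - A 1 1` is nonzero; b is the quotient by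
  -- it of the matching expression in B.
  by_cases h01 : A 0 1 = 0
  · by_cases h10 : A 1 0 = 0
    · have hne : A 0 0 - A 1 1 ≠ 0 := by
        intro h0
        apply hA (A 0 0)
        ext i j
        fin_cases i <;> fin_cases j <;> simp [h01, h10]
        linear_combination -h0
      simp only [h01, h10, mul_zero, zero_mul, add_zero, zero_add] at h2 h3
      have hB1 : B 0 1 = 0 := (mul_eq_zero.1 (by linear_combination -h2 :
        (A 0 0 - A 1 1) * B 0 1 = 0)).resolve_left hne
      have hB2 : B 1 0 = 0 := (mul_eq_zero.1 (by linear_combination h3 :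
        (A 0 0 - A 1 1) * B 1 0 = 0)).resolve_left hne
      refine ⟨B 0 0 - (B 0 0 - B 1 1) / (A 0 0 - A 1 1) * A 0 0,
        (B 0 0 - B 1 1) / (A 0 0 - A 1 1), ?_⟩
      ext i j
      fin_cases i <;> fin_cases j <;> simp [h01, h10, hB1, hB2]
      field_simp
      ring
    · refine ⟨B 0 0 - B 1 0 / A 1 0 * A 0 0, B 1 0 / A 1 0, ?_⟩
      ext i j
      fin_cases i <;> fin_cases j <;> simp [h01, h10]
      · simp only [h01, zero_mul, add_zero] at h1
        exact (mul_eq_zero.1 (by linear_combination h1)).resolve_right h10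
      · field_simp
        linear_combination h3
  · refine ⟨B 0 0 - B 0 1 / A 0 1 * A 0 0, B 0 1 / A 0 1, ?_⟩
    ext i j
    fin_cases i <;> fin_cases j <;> simp [h01]
    · field_simp
      linear_combination -h1
    · field_simp
      linear_combination -h2

/-- The traceless matrix with rows `(a, b)` and `(c, -a)`. -/
def tracelessMatrix (v : F × F × F) : Matrix (Fin 2) (Fin 2) F :=
  !![v.1, v.2.1; v.2.2, -v.1]

/-- The negative of the determinant of `tracelessMatrix v`. -/
def tracelessDisc (v : F × F × F) : F := v.1 ^ 2 + v.2.1 * v.2.2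

theorem tracelessMatrix_smul (c : F) (v : F × F × F) :
    tracelessMatrix (c • v) = c • tracelessMatrix v := by
  ext i j
  fin_cases i <;> fin_cases j <;> simp [tracelessMatrix]

theorem tracelessMatrix_injective :
    Function.Injective (tracelessMatrix : F × F × F → Matrix (Fin 2) (Fin 2) F) := by
  rintro ⟨a, b, c⟩ ⟨a', b', c'⟩ h
  have h1 := congrFun (congrFun h 0) 0
  have h2 := congrFun (congrFun h 0) 1
  have h3 := congrFun (congrFun h 1) 0
  simp_all [tracelessMatrix]

theorem trace_tracelessMatrix (v : F × F × F) : (tracelessMatrix v).trace = 0 := by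
  simp [tracelessMatrix, Matrix.trace_fin_two]

theorem det_tracelessMatrix (v : F × F × F) : (tracelessMatrix v).det = -tracelessDisc v := by
  simp [tracelessMatrix, Matrix.det_fin_two, tracelessDisc]
  ring

theorem tracelessDisc_smul (c : F) (v : F × F × F) :
    tracelessDisc (c • v) = c ^ 2 * tracelessDisc v := by
  simp [tracelessDisc]
  ring

theorem tracelessMatrix_mul_self (v : F × F × F) :
    tracelessMatrix v * tracelessMatrix v = tracelessDisc v • 1 := by
  ext i j
  fin_cases i <;> fin_cases j <;> simp [tracelessMatrix, tracelessDisc, Matrix.mul_apply] <;> ring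

theorem det_smul_one_add_smul_tracelessMatrix (a b : F) (v : F × F × F) :
    (a • 1 + b • tracelessMatrix v).det = a ^ 2 - b ^ 2 * tracelessDisc v := by
  simp [tracelessMatrix, Matrix.det_fin_two, tracelessDisc]
  ring

theorem tracelessMatrix_ne_smul_one (h2 : (2 : F) ≠ 0) {v : F × F × F} (hv : v ≠ 0) (a : F) :
    tracelessMatrix v ≠ a • 1 := by
  intro h
  have ha : a = 0 := by
    have := congrArg Matrix.trace h
    rw [trace_tracelessMatrix] at this
    simpa [h2] using this.symm
  apply hv
  apply tracelessMatrix_injective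
  rw [h, ha]
  ext i j
  fin_cases i <;> fin_cases j <;> simp [tracelessMatrix]

theorem smul_one_add_smul_tracelessMatrix_inj (h2 : (2 : F) ≠ 0) {v : F × F × F} (hv : v ≠ 0)
    {a b a' b' : F}
    (h : a • (1 : Matrix (Fin 2) (Fin 2) F) + b • tracelessMatrix v
      = a' • 1 + b' • tracelessMatrix v) : a = a' ∧ b = b' := by
  have ha : a = a' := by
    have := congrArg Matrix.trace h
    simpa [trace_tracelessMatrix, h2] using this
  refine ⟨ha, ?_⟩
  rw [ha, add_right_inj, ← sub_eq_zero, ← sub_smul] at h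
  rcases smul_eq_zero.1 h with h | h
  · exact sub_eq_zero.1 h
  · exact absurd (by simpa using h) (tracelessMatrix_ne_smul_one h2 hv 0)

theorem exists_eq_smul_one_add_tracelessMatrix (h2 : (2 : F) ≠ 0)
    (A : Matrix (Fin 2) (Fin 2) F) : ∃ (a : F) (v : F × F × F),
      A = a • 1 + tracelessMatrix v := by
  refine ⟨(A 0 0 + A 1 1) / 2, ((A 0 0 - A 1 1) / 2, A 0 1, A 1 0), ?_⟩
  ext i j
  fin_cases i <;> fin_cases j <;> simp [tracelessMatrix] <;> field_simp <;> ring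

/-! ### Projective classes commuting with a matrix -/

theorem Matrix.ProjGenLinGroup.mk_eq_mk_iff_exists_smul {A B : GL (Fin 2) F} :
    (mk A : PGL(2, F)) = mk B ↔ ∃ u : F, u ≠ 0 ∧ (B : Matrix (Fin 2) (Fin 2) F) = u • A.val := by
  rw [mk_eq_mk_iff]
  have key (u : Fˣ) : (A * GeneralLinearGroup.scalar (Fin 2) u).val = (u : F) • A.val := by
    ext i j
    fin_cases i <;> fin_cases j <;> simp [GeneralLinearGroup.scalar, mul_comm]
  constructor
  · rintro ⟨u, rfl⟩
    exact ⟨u, u.ne_zero, key u⟩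
  · rintro ⟨u, hu, h⟩
    exact ⟨Units.mk0 u hu, Units.ext (by rw [key, h]; rfl)⟩

theorem Matrix.ProjGenLinGroup.mk_eq_one_iff_exists_smul {A : GL (Fin 2) F} :
    (mk A : PGL(2, F)) = 1 ↔ ∃ u : F, A.val = u • 1 := by
  rw [← map_one mk, eq_comm, mk_eq_mk_iff_exists_smul]
  refine ⟨fun ⟨u, _, h⟩ => ⟨u, h⟩, fun ⟨u, h⟩ => ⟨u, ?_, h⟩⟩
  rintro rfl
  have := A.isUnit.ne_zero
  simp_all

/-- The elements of `PGL(2, F)` represented by matrices commuting with `M`. -/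
def CommutesWith (M : Matrix (Fin 2) (Fin 2) F) (x : PGL(2, F)) : Prop :=
  ∃ A : GL (Fin 2) F, mk A = x ∧ Commute A.val M

/-- Two lifts differ by a scalar, so the choice is immaterial. Commutation is exact, not merely up
to a scalar. -/
theorem commutesWith_mk {M : Matrix (Fin 2) (Fin 2) F} {A : GL (Fin 2) F} :
    CommutesWith M (mk A) ↔ Commute A.val M := by
  refine ⟨?_, fun h => ⟨A, rfl, h⟩⟩
  rintro ⟨B, hB, h⟩
  obtain ⟨u, -, hu⟩ := mk_eq_mk_iff_exists_smul.1 hB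
  rw [hu]
  exact h.smul_left u

theorem CommutesWith.zpow {M : Matrix (Fin 2) (Fin 2) F} {x : PGL(2, F)}
    (h : CommutesWith M x) (k : ℤ) : CommutesWith M (x ^ k) := by
  obtain ⟨A, rfl, h⟩ := h
  rw [← map_zpow, commutesWith_mk]
  exact h.units_zpow_left k

/-- Since A^k is not scalar, its centralizer is F[A^k]; hence M is a polynomial in A^k and commutes
with A. -/
theorem CommutesWith.of_zpow {M : Matrix (Fin 2) (Fin 2) F}
    {x : PGL(2, F)} {k : ℤ} (hx : x ^ k ≠ 1) (h : CommutesWith M (x ^ k)) :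
    CommutesWith M x := by
  obtain ⟨A, rfl⟩ := mk_surjective x
  rw [← map_zpow] at h hx
  rw [commutesWith_mk] at h ⊢
  have hA : ∀ a : F, (A ^ k).val ≠ a • 1 := fun a ha =>
    hx (mk_eq_one_iff_exists_smul.2 ⟨a, ha⟩)
  obtain ⟨a, b, hM⟩ := Matrix.exists_eq_smul_one_add_smul_of_commute hA h.symm
  have hk : Commute A.val (A ^ k).val := by
    have := congrArg Units.val (Commute.self_zpow A k).eq
    exact this
  rw [hM]
  exact ((Commute.one_right _).smul_right a).add_right (hk.smul_right b)

theorem CommutesWith.of_reachable {M : Matrix (Fin 2) (Fin 2) F} {x y : {x : PGL(2, F) // x ≠ 1}}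
    (h : (properPowerGraph PGL(2, F)).Reachable x y) (hx : CommutesWith M x) :
    CommutesWith M y :=
  h.properPowerGraph_induction (P := CommutesWith M) (fun _ k _ h => h.zpow k)
    (fun _ _ hk h => h.of_zpow hk) hx

end Matrices
-- Components of elements with nonzero discriminant
section Components

variable {F : Type*} [Field F]

/-- The invertible traceless matrix attached to a vector of nonzero discriminant. -/
def tracelessGL (v : F × F × F) (hv : tracelessDisc v ≠ 0) : GL (Fin 2) F :=
  GeneralLinearGroup.mkOfDetNeZero (tracelessMatrix v)
    (by rw [det_tracelessMatrix]; exact neg_ne_zero.2 hv)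

theorem val_tracelessGL (v : F × F × F) (hv : tracelessDisc v ≠ 0) :
    (tracelessGL v hv).val = tracelessMatrix v := rfl

theorem ne_zero_of_tracelessDisc_ne_zero {v : F × F × F} (hv : tracelessDisc v ≠ 0) : v ≠ 0 := by
  rintro rfl
  exact hv (by simp [tracelessDisc])

theorem mk_ne_one_of_smul_one_add_smul (h2 : (2 : F) ≠ 0) {v : F × F × F} (hv : v ≠ 0)
    {A : GL (Fin 2) F} {a b : F} (hb : b ≠ 0) (hA : A.val = a • 1 + b • tracelessMatrix v) :
    (mk A : PGL(2, F)) ≠ 1 := by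
  intro h
  obtain ⟨u, hu⟩ := mk_eq_one_iff_exists_smul.1 h
  refine hb (smul_one_add_smul_tracelessMatrix_inj h2 hv (a := a) (a' := u) (b' := 0) ?_).2
  rw [← hA, hu, zero_smul, add_zero]

theorem mk_tracelessGL_ne_one (h2 : (2 : F) ≠ 0) (v : F × F × F) (hv : tracelessDisc v ≠ 0) :
    (mk (tracelessGL v hv) : PGL(2, F)) ≠ 1 :=
  mk_ne_one_of_smul_one_add_smul h2 (ne_zero_of_tracelessDisc_ne_zero hv) (a := 0) one_ne_zero
    (by simp [val_tracelessGL])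

/-- The eigenvalue `a + b s` of `A = a + b M`, where `M = tracelessMatrix v` and `s` is an
eigenvalue of `M`, as a function on the centralizer of `M`. -/
noncomputable def centralizerEigenvalue {K : Type*} [Field K] [Algebra F K] (h2 : (2 : F) ≠ 0)
    (v : F × F × F) (hv : tracelessDisc v ≠ 0) (s : K)
    (hs : s ^ 2 = algebraMap F K (tracelessDisc v)) :
    Subgroup.centralizer {tracelessGL v hv} →* K where
  -- For A = a + bM, tr A = 2a and tr(AM) = 2bs², so this is a + bs without choosing a and b.
  toFun A := (algebraMap F K A.1.val.trace +
    algebraMap F K (A.1.val * tracelessMatrix v).trace / s) / 2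
  map_one' := by
    have h2K : algebraMap F K 2 = 2 := map_ofNat _ 2
    have h2' : (2 : K) ≠ 0 := h2K ▸ (map_ne_zero (algebraMap F K)).2 h2
    simp [trace_tracelessMatrix, h2', h2K]
  map_mul' A B := by
    have h2K : algebraMap F K 2 = 2 := map_ofNat _ 2
    have h2' : (2 : K) ≠ 0 := h2K ▸ (map_ne_zero (algebraMap F K)).2 h2
    have hs0 : s ≠ 0 := by
      rintro rfl
      exact hv (by simpa using hs.symm)
    have key (A : Subgroup.centralizer {tracelessGL v hv}) :
        ∃ a b : F, A.1.val = a • 1 + b • tracelessMatrix v := by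
      refine Matrix.exists_eq_smul_one_add_smul_of_commute
        (tracelessMatrix_ne_smul_one h2 (ne_zero_of_tracelessDisc_ne_zero hv)) ?_
      exact (congrArg Units.val (Subgroup.mem_centralizer_singleton_iff.1 A.2))
    have htr (a b : F) : algebraMap F K (a • 1 + b • tracelessMatrix v).trace
        = 2 * algebraMap F K a := by
      simp [trace_tracelessMatrix, mul_comm, h2K]
    have htrM (a b : F) : algebraMap F K ((a • 1 + b • tracelessMatrix v) * tracelessMatrix v).trace
        = 2 * algebraMap F K b * s ^ 2 := by
      rw [hs]
      simp [add_mul, tracelessMatrix_mul_self, trace_tracelessMatrix, h2K]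
      ring
    obtain ⟨a, b, hA⟩ := key A
    obtain ⟨c, d, hB⟩ := key B
    have hAB : (A * B).1.val = (a * c + b * d * tracelessDisc v) • 1
        + (a * d + b * c) • tracelessMatrix v := by
      simp only [Subgroup.coe_mul, Units.val_mul, hA, hB, add_mul, mul_add, smul_mul_assoc,
        mul_smul_comm, tracelessMatrix_mul_self, one_mul, mul_one]
      module
    rw [hA, hB, hAB, htr, htr, htr, htrM, htrM, htrM]
    simp only [map_add, map_mul, ← hs]
    field_simp
    ring

theorem centralizerEigenvalue_apply {K : Type*} [Field K] [Algebra F K] (h2 : (2 : F) ≠ 0)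
    (v : F × F × F) (hv : tracelessDisc v ≠ 0) (s : K)
    (hs : s ^ 2 = algebraMap F K (tracelessDisc v))
    (A : Subgroup.centralizer {tracelessGL v hv}) :
    centralizerEigenvalue h2 v hv s hs A = (algebraMap F K A.1.val.trace +
      algebraMap F K (A.1.val * tracelessMatrix v).trace / s) / 2 := rfl

theorem exists_generator_of_commutesWith [Finite F] (h2 : (2 : F) ≠ 0) (v : F × F × F)
    (hv : tracelessDisc v ≠ 0) : ∃ g : PGL(2, F), ∀ x : PGL(2, F),
      CommutesWith (tracelessMatrix v) x → ∃ k : ℤ, x = g ^ k := by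
  let K := AlgebraicClosure F
  have h2K : algebraMap F K 2 = 2 := map_ofNat _ 2
  have h2' : (2 : K) ≠ 0 := h2K ▸ (map_ne_zero (algebraMap F K)).2 h2
  obtain ⟨s, hs⟩ := IsAlgClosed.exists_pow_nat_eq (algebraMap F K (tracelessDisc v)) two_pos
  have hs0 : s ≠ 0 := by
    rintro rfl
    exact hv (by simpa using hs.symm)
  let φ := (centralizerEigenvalue h2 v hv s hs).toHomUnits
  let ψ := (centralizerEigenvalue h2 v hv (-s) (by rw [neg_sq, hs])).toHomUnits
  -- χ sends a + bM to the eigenvalue ratio (a + bs)/(a - bs), which is 1 only if b = 0, that is, on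
  -- scalars.
  let χ := φ / ψ
  have hker (A : Subgroup.centralizer {tracelessGL v hv}) (hA : χ A = 1) :
      (mk A.1 : PGL(2, F)) = 1 := by
    have h1 : φ A = ψ A := div_eq_one.1 hA
    have h3 := congrArg Units.val h1
    simp only [φ, ψ, MonoidHom.coe_toHomUnits, centralizerEigenvalue_apply] at h3
    have h4 : algebraMap F K (A.1.val * tracelessMatrix v).trace = 0 := by
      rw [div_neg, div_left_inj' h2'] at h3
      have : (2 : K) * (algebraMap F K (A.1.val * tracelessMatrix v).trace / s) = 0 := by
        linear_combination h3
      exact (div_eq_zero_iff.1 ((mul_eq_zero.1 this).resolve_left h2')).resolve_right hs0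
    have h5 : (A.1.val * tracelessMatrix v).trace = 0 := by simpa using h4
    obtain ⟨a, b, hab⟩ := Matrix.exists_eq_smul_one_add_smul_of_commute
      (tracelessMatrix_ne_smul_one h2 (ne_zero_of_tracelessDisc_ne_zero hv))
      (show Commute A.1.val (tracelessMatrix v) from
        (congrArg Units.val (Subgroup.mem_centralizer_singleton_iff.1 A.2)))
    have hb : b = 0 := by
      rw [hab] at h5
      simpa [add_mul, tracelessMatrix_mul_self, trace_tracelessMatrix, h2, hv] using h5
    exact mk_eq_one_iff_exists_smul.2 ⟨a, by rw [hab, hb, zero_smul, add_zero]⟩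
  -- A finite subgroup of the units of a field is cyclic; a preimage of a generator generates modulo
  -- scalars.
  have : Finite χ.range := Finite.of_surjective _ χ.rangeRestrict_surjective
  obtain ⟨⟨_, g, rfl⟩, hg⟩ := IsCyclic.exists_generator (α := χ.range)
  refine ⟨mk g.1, fun x hx => ?_⟩
  obtain ⟨A, rfl, hA⟩ := hx
  have hA' : A ∈ Subgroup.centralizer {tracelessGL v hv} :=
    Subgroup.mem_centralizer_singleton_iff.2 (Units.ext hA.eq)
  obtain ⟨k, hk⟩ := hg ⟨χ ⟨A, hA'⟩, ⟨A, hA'⟩, rfl⟩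
  have hk' : χ g ^ k = χ ⟨A, hA'⟩ := congrArg Subtype.val hk
  refine ⟨k, ?_⟩
  have := hker (⟨A, hA'⟩ * (g ^ k)⁻¹) (by rw [map_mul, map_inv, map_zpow, hk', mul_inv_cancel])
  rw [← map_zpow, ← mul_inv_eq_one, ← map_inv, ← map_mul]
  exact this

theorem reachable_of_commutesWith [Finite F] (h2 : (2 : F) ≠ 0) {v : F × F × F}
    (hv : tracelessDisc v ≠ 0) {x y : {x : PGL(2, F) // x ≠ 1}}
    (hx : CommutesWith (tracelessMatrix v) x) (hy : CommutesWith (tracelessMatrix v) y) :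
    (properPowerGraph PGL(2, F)).Reachable x y := by
  obtain ⟨g, hg⟩ := exists_generator_of_commutesWith h2 v hv
  obtain ⟨k, hk⟩ := hg x hx
  obtain ⟨l, hl⟩ := hg y hy
  exact properPowerGraph_reachable_of_zpow_of_zpow hk hl

/-- The component of the involution given by an invertible traceless matrix. -/
def semisimpleComponent (h2 : (2 : F) ≠ 0) (v : {v : F × F × F // tracelessDisc v ≠ 0}) :
    (properPowerGraph PGL(2, F)).ConnectedComponent :=
  (properPowerGraph PGL(2, F)).connectedComponentMk
    ⟨mk (tracelessGL v.1 v.2), mk_tracelessGL_ne_one h2 v.1 v.2⟩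

theorem eq_smul_of_commute_tracelessMatrix (h2 : (2 : F) ≠ 0) {v w : F × F × F}
    (hv : v ≠ 0) (h : Commute (tracelessMatrix w) (tracelessMatrix v)) :
    ∃ b : F, w = b • v := by
  obtain ⟨a, b, hab⟩ := Matrix.exists_eq_smul_one_add_smul_of_commute
    (tracelessMatrix_ne_smul_one h2 hv) h
  have ha : a = 0 := by
    have := congrArg Matrix.trace hab
    simpa [trace_tracelessMatrix, h2] using this
  exact ⟨b, tracelessMatrix_injective (by rw [tracelessMatrix_smul, hab, ha]; simp)⟩

theorem semisimpleComponent_eq_iff [Finite F] (h2 : (2 : F) ≠ 0)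
    (v w : {v : F × F × F // tracelessDisc v ≠ 0}) :
    semisimpleComponent h2 w = semisimpleComponent h2 v ↔ ∃ b : F, w.1 = b • v.1 := by
  have hvv : CommutesWith (tracelessMatrix v.1) (mk (tracelessGL v.1 v.2)) :=
    commutesWith_mk.2 (Commute.refl _)
  constructor
  · intro h
    have hr := SimpleGraph.ConnectedComponent.exact h
    exact eq_smul_of_commute_tracelessMatrix h2 (ne_zero_of_tracelessDisc_ne_zero v.2)
      (commutesWith_mk.1 (CommutesWith.of_reachable hr.symm hvv))
  · rintro ⟨b, hb⟩
    refine SimpleGraph.ConnectedComponent.sound (reachable_of_commutesWith h2 v.2 ?_ hvv)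
    refine commutesWith_mk.2 ?_
    rw [val_tracelessGL, hb, tracelessMatrix_smul]
    exact (Commute.refl _).smul_left b

/-- Each fibre is a line without its origin, hence a free orbit of `Fˣ`. -/
theorem card_range_semisimpleComponent [Finite F] (h2 : (2 : F) ≠ 0) :
    Nat.card {v : F × F × F // tracelessDisc v ≠ 0}
      = Nat.card (Set.range (semisimpleComponent h2)) * Nat.card Fˣ := by
  apply Nat.card_eq_card_range_mul
  intro v
  refine ⟨fun c => ⟨(c : F) • v.1, ?_⟩, fun c d hcd => ?_, fun w => ?_⟩
  · rw [tracelessDisc_smul]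
    exact mul_ne_zero (pow_ne_zero _ c.ne_zero) v.2
  · exact Units.ext (smul_left_injective F (ne_zero_of_tracelessDisc_ne_zero v.2)
      (congrArg Subtype.val hcd))
  · rw [semisimpleComponent_eq_iff]
    constructor
    · rintro ⟨b, hb⟩
      have hb0 : b ≠ 0 := by
        rintro rfl
        exact ne_zero_of_tracelessDisc_ne_zero w.2 (by rw [hb, zero_smul])
      exact ⟨Units.mk0 b hb0, Subtype.ext hb.symm⟩
    · rintro ⟨c, rfl⟩
      exact ⟨c, rfl⟩

/-! ### Unipotent elements -/

/-- The unipotent matrix `1 + tracelessMatrix v` attached to a vector of discriminant zero. -/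
def unipotentGL (v : F × F × F) (hv : tracelessDisc v = 0) : GL (Fin 2) F :=
  GeneralLinearGroup.mkOfDetNeZero (1 + tracelessMatrix v) (by
    have := det_smul_one_add_smul_tracelessMatrix 1 1 v
    simp_all)

theorem val_unipotentGL (v : F × F × F) (hv : tracelessDisc v = 0) :
    (unipotentGL v hv).val = 1 + tracelessMatrix v := rfl

theorem tracelessDisc_smul_eq_zero {v : F × F × F} (hv : tracelessDisc v = 0) (c : F) :
    tracelessDisc (c • v) = 0 := by
  rw [tracelessDisc_smul, hv, mul_zero]

theorem unipotentGL_smul_mul (v : F × F × F) (hv : tracelessDisc v = 0) (c d : F) :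
    unipotentGL (c • v) (tracelessDisc_smul_eq_zero hv c) *
      unipotentGL (d • v) (tracelessDisc_smul_eq_zero hv d)
      = unipotentGL ((c + d) • v) (tracelessDisc_smul_eq_zero hv _) := by
  apply Units.ext
  simp only [Units.val_mul, val_unipotentGL, tracelessMatrix_smul, add_mul, mul_add, one_mul,
    mul_one, smul_mul_assoc, mul_smul_comm, tracelessMatrix_mul_self, hv, zero_smul, smul_zero,
    add_zero]
  module

/-- The one-parameter group `c ↦ 1 + c M` for nilpotent `M = tracelessMatrix v`. -/
def unipotentHom (v : F × F × F) (hv : tracelessDisc v = 0) :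
    Multiplicative F →* GL (Fin 2) F :=
  MonoidHom.mk' (fun c => unipotentGL (c.toAdd • v) (tracelessDisc_smul_eq_zero hv _))
    (fun c d => (unipotentGL_smul_mul v hv c.toAdd d.toAdd).symm)

theorem unipotentGL_smul_zpow (v : F × F × F) (hv : tracelessDisc v = 0) (c : F) (k : ℤ) :
    unipotentGL (c • v) (tracelessDisc_smul_eq_zero hv c) ^ k
      = unipotentGL ((k * c) • v) (tracelessDisc_smul_eq_zero hv _) := by
  have := map_zpow (unipotentHom v hv) (Multiplicative.ofAdd c) k
  rw [← ofAdd_zsmul] at this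
  rw [← zsmul_eq_mul]
  exact this.symm

theorem mk_unipotentGL_ne_one (h2 : (2 : F) ≠ 0) (v : F × F × F) (hv0 : v ≠ 0)
    (hv : tracelessDisc v = 0) : (mk (unipotentGL v hv) : PGL(2, F)) ≠ 1 :=
  mk_ne_one_of_smul_one_add_smul h2 hv0 (a := 1) one_ne_zero (by simp [val_unipotentGL])

theorem eq_of_mk_unipotentGL_smul_eq (h2 : (2 : F) ≠ 0) {v : F × F × F} (hv0 : v ≠ 0)
    (hv : tracelessDisc v = 0) {c d : F}
    (h : (mk (unipotentGL (c • v) (tracelessDisc_smul_eq_zero hv c)) : PGL(2, F))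
      = mk (unipotentGL (d • v) (tracelessDisc_smul_eq_zero hv d))) : c = d := by
  obtain ⟨u, -, hu⟩ := mk_eq_mk_iff_exists_smul.1 h
  simp only [val_unipotentGL, tracelessMatrix_smul, smul_add, smul_smul] at hu
  obtain ⟨h1, h3⟩ := smul_one_add_smul_tracelessMatrix_inj h2 hv0 (a := 1) (a' := u)
    (by rw [one_smul]; exact hu)
  rw [h3, ← h1, one_mul]

/-- The component of the unipotent element given by a nonzero nilpotent matrix. -/
def unipotentComponent (h2 : (2 : F) ≠ 0)
    (v : {v : F × F × F // v ≠ 0 ∧ tracelessDisc v = 0}) :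
    (properPowerGraph PGL(2, F)).ConnectedComponent :=
  (properPowerGraph PGL(2, F)).connectedComponentMk
    ⟨mk (unipotentGL v.1 v.2.2), mk_unipotentGL_ne_one h2 v.1 v.2.1 v.2.2⟩

theorem exists_mk_eq_unipotentGL_smul (h2 : (2 : F) ≠ 0) {v : F × F × F} (hv0 : v ≠ 0)
    (hv : tracelessDisc v = 0) {x : PGL(2, F)} (hx : CommutesWith (tracelessMatrix v) x) :
    ∃ c : F, x = mk (unipotentGL (c • v) (tracelessDisc_smul_eq_zero hv c)) := by
  obtain ⟨A, rfl, hA⟩ := hx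
  obtain ⟨a, b, hab⟩ := Matrix.exists_eq_smul_one_add_smul_of_commute
    (tracelessMatrix_ne_smul_one h2 hv0) hA
  have ha : a ≠ 0 := by
    rintro rfl
    have := A.det_ne_zero
    rw [hab, det_smul_one_add_smul_tracelessMatrix, hv] at this
    simp at this
  refine ⟨b / a, mk_eq_mk_iff_exists_smul.2 ⟨a⁻¹, inv_ne_zero ha, ?_⟩⟩
  rw [hab, val_unipotentGL, tracelessMatrix_smul, smul_add, smul_smul, smul_smul,
    inv_mul_cancel₀ ha, one_smul, div_eq_inv_mul]

theorem commutesWith_unipotentGL_smul {v : F × F × F} (hv : tracelessDisc v = 0) (c : F) :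
    CommutesWith (tracelessMatrix v)
      (mk (unipotentGL (c • v) (tracelessDisc_smul_eq_zero hv c))) := by
  rw [commutesWith_mk, val_unipotentGL, tracelessMatrix_smul]
  exact (Commute.one_left _).add_left ((Commute.refl _).smul_left c)

/-- The elements represented by `1 + c M`, where `M = tracelessMatrix v` is nilpotent and `c` is a
nonzero element of the prime field. -/
def IsPrimeMultiple (p : ℕ) [CharP F p] {v : F × F × F} (hv : tracelessDisc v = 0)
    (x : PGL(2, F)) : Prop :=
  ∃ c : ZMod p, c ≠ 0 ∧
    x = mk (unipotentGL ((ZMod.castHom dvd_rfl F c) • v) (tracelessDisc_smul_eq_zero hv _))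

/-- A power multiplies the coefficient of M by an integer. A root again has the form 1 + dM with kd
= c, and k is invertible mod p because c ≠ 0, so d stays in the prime field. -/
theorem isPrimeMultiple_of_reachable {p : ℕ} [Fact p.Prime] [CharP F p] (h2 : (2 : F) ≠ 0)
    {v : F × F × F} (hv0 : v ≠ 0) (hv : tracelessDisc v = 0) {x y : {x : PGL(2, F) // x ≠ 1}}
    (h : (properPowerGraph PGL(2, F)).Reachable x y) (hx : IsPrimeMultiple p hv x.1) :
    IsPrimeMultiple p hv y.1 := by
  refine h.properPowerGraph_induction ?_ ?_ hx
  · rintro x k hk ⟨c, -, rfl⟩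
    have hpow : (mk (unipotentGL ((ZMod.castHom dvd_rfl F c) • v)
        (tracelessDisc_smul_eq_zero hv _)) : PGL(2, F)) ^ k =
        mk (unipotentGL ((ZMod.castHom dvd_rfl F (k * c)) • v)
          (tracelessDisc_smul_eq_zero hv _)) := by
      rw [← map_zpow, unipotentGL_smul_zpow v hv]
      simp only [map_mul, map_intCast]
    refine ⟨k * c, fun h0 => hk ?_, hpow⟩
    rw [hpow, ← zpow_zero (mk (unipotentGL v hv)), ← map_zpow]
    simp only [h0, map_zero, zero_smul, zpow_zero]
    congr 1
    apply Units.ext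
    rw [val_unipotentGL]
    ext i j
    fin_cases i <;> fin_cases j <;> simp [tracelessMatrix]
  · rintro x k hk ⟨c, hc, hxc⟩
    obtain ⟨d, rfl⟩ := exists_mk_eq_unipotentGL_smul h2 hv0 hv
      (CommutesWith.of_zpow hk (hxc ▸ commutesWith_unipotentGL_smul hv _))
    rw [← map_zpow, unipotentGL_smul_zpow v hv] at hxc
    have hkd := eq_of_mk_unipotentGL_smul_eq h2 hv0 hv hxc
    have hc' : ZMod.castHom (dvd_refl p) F c ≠ 0 := (map_ne_zero _).2 hc
    have hk0 : (k : F) ≠ 0 := by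
      rintro h0
      exact hc' (by rw [← hkd, h0, zero_mul])
    have hk1 : (k : ZMod p) ≠ 0 := by
      intro h0
      apply hk0
      rw [← map_intCast (ZMod.castHom (dvd_refl p) F), h0, map_zero]
    refine ⟨(k : ZMod p)⁻¹ * c, mul_ne_zero (inv_ne_zero hk1) hc, ?_⟩
    congr 3
    rw [map_mul, map_inv₀, map_intCast, ← hkd, inv_mul_cancel_left₀ hk0]

theorem unipotentComponent_eq_iff {p : ℕ} [Fact p.Prime] [CharP F p] (h2 : (2 : F) ≠ 0)
    (v w : {v : F × F × F // v ≠ 0 ∧ tracelessDisc v = 0}) :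
    unipotentComponent h2 w = unipotentComponent h2 v ↔
      ∃ c : ZMod p, c ≠ 0 ∧ w.1 = ZMod.castHom (dvd_refl p) F c • v.1 := by
  constructor
  · intro h
    have hr := SimpleGraph.ConnectedComponent.exact h
    obtain ⟨c, hc, h⟩ := isPrimeMultiple_of_reachable (p := p) h2 v.2.1 v.2.2 hr.symm
      ⟨1, one_ne_zero, by simp⟩
    refine ⟨c, hc, ?_⟩
    obtain ⟨u, -, hu⟩ := mk_eq_mk_iff_exists_smul.1 h
    rw [val_unipotentGL, val_unipotentGL] at hu
    -- Both unipotent matrices have trace 2, which rules out rescaling.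
    have hu1 : u = 1 := by
      have := congrArg Matrix.trace hu
      simp only [Matrix.trace_add, Matrix.trace_smul, trace_tracelessMatrix] at this
      simpa [h2] using this.symm
    rw [hu1, one_smul, add_right_inj] at hu
    exact (tracelessMatrix_injective hu).symm
  · rintro ⟨c, hc, h⟩
    obtain ⟨k, rfl⟩ := ZMod.intCast_surjective c
    refine (SimpleGraph.ConnectedComponent.sound (properPowerGraph_reachable_zpow (k := k) ?_)).symm
    rw [← map_zpow]
    have := unipotentGL_smul_zpow v.1 v.2.2 1 k
    simp only [one_smul, mul_one] at this
    rw [this]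
    simp only [h, map_intCast]

theorem card_range_unipotentComponent [Finite F] (p : ℕ) [Fact p.Prime] [CharP F p]
    (h2 : (2 : F) ≠ 0) :
    Nat.card {v : F × F × F // v ≠ 0 ∧ tracelessDisc v = 0}
      = Nat.card (Set.range (unipotentComponent h2)) * Nat.card (ZMod p)ˣ := by
  apply Nat.card_eq_card_range_mul
  intro v
  have hne (c : (ZMod p)ˣ) : ZMod.castHom (dvd_refl p) F c ≠ 0 := (map_ne_zero _).2 c.ne_zero
  refine ⟨fun c => ⟨ZMod.castHom (dvd_refl p) F c • v.1, smul_ne_zero (hne c) v.2.1,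
    tracelessDisc_smul_eq_zero v.2.2 _⟩, fun c d hcd => ?_, fun w => ?_⟩
  · exact Units.ext ((ZMod.castHom (dvd_refl p) F).injective
      (smul_left_injective F v.2.1 (congrArg Subtype.val hcd)))
  · rw [unipotentComponent_eq_iff (p := p)]
    constructor
    · rintro ⟨b, hb, h⟩
      exact ⟨Units.mk0 b hb, Subtype.ext h.symm⟩
    · rintro ⟨c, rfl⟩
      exact ⟨c, c.ne_zero, rfl⟩

/-! ### The count -/

/-- A shared component would make the two traceless matrices commute, hence be proportional, against
their discriminants. -/
theorem semisimpleComponent_ne_unipotentComponent (h2 : (2 : F) ≠ 0)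
    (v : {v : F × F × F // tracelessDisc v ≠ 0})
    (w : {v : F × F × F // v ≠ 0 ∧ tracelessDisc v = 0}) :
    semisimpleComponent h2 v ≠ unipotentComponent h2 w := by
  intro h
  have hr := SimpleGraph.ConnectedComponent.exact h
  have hc := CommutesWith.of_reachable (M := tracelessMatrix w.1) hr.symm
    (by simpa using commutesWith_unipotentGL_smul w.2.2 1)
  obtain ⟨b, hb⟩ := eq_smul_of_commute_tracelessMatrix h2 w.2.1 (commutesWith_mk.1 hc)
  exact v.2 (by rw [hb]; exact tracelessDisc_smul_eq_zero w.2.2 b)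

theorem mem_range_semisimpleComponent_or_unipotentComponent [Finite F] (h2 : (2 : F) ≠ 0)
    (c : (properPowerGraph PGL(2, F)).ConnectedComponent) :
    c ∈ Set.range (semisimpleComponent h2) ∨ c ∈ Set.range (unipotentComponent h2) := by
  induction c using SimpleGraph.ConnectedComponent.ind with
  | h x =>
  obtain ⟨x, hx⟩ := x
  obtain ⟨A, rfl⟩ := mk_surjective x
  obtain ⟨a, v, hA⟩ := exists_eq_smul_one_add_tracelessMatrix h2 A.val
  have hcomm : CommutesWith (tracelessMatrix v) (mk A) := by
    rw [commutesWith_mk, hA]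
    exact ((Commute.one_left _).smul_left a).add_left (Commute.refl _)
  by_cases hv : tracelessDisc v = 0
  · right
    have hv0 : v ≠ 0 := by
      rintro rfl
      refine hx (mk_eq_one_iff_exists_smul.2 ⟨a, hA.trans ?_⟩)
      ext i j
      fin_cases i <;> fin_cases j <;> simp [tracelessMatrix]
    obtain ⟨c, hc⟩ := exists_mk_eq_unipotentGL_smul h2 hv0 hv hcomm
    have hc0 : c ≠ 0 := by
      rintro rfl
      refine hx (hc.trans (mk_eq_one_iff_exists_smul.2 ⟨1, ?_⟩))
      rw [val_unipotentGL, tracelessMatrix_smul]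
      simp
    exact ⟨⟨c • v, smul_ne_zero hc0 hv0, tracelessDisc_smul_eq_zero hv c⟩,
      congrArg (properPowerGraph PGL(2, F)).connectedComponentMk (Subtype.ext hc.symm)⟩
  · left
    exact ⟨⟨v, hv⟩, SimpleGraph.ConnectedComponent.sound
      (reachable_of_commutesWith h2 hv (commutesWith_mk.2 (Commute.refl _)) hcomm)⟩

/-- The affine quadric cone `a ^ 2 + b c = 0` is in bijection with the plane. -/
noncomputable def tracelessDiscZeroEquiv :
    {v : F × F × F // tracelessDisc v = 0} ≃ F × F where
  -- If c ≠ 0, then a is free and b = -a²/c; if c = 0, then a = 0 and b is free.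
  toFun v := open Classical in (v.1.2.2, if v.1.2.2 = 0 then v.1.2.1 else v.1.1)
  invFun w := open Classical in
    ⟨if w.1 = 0 then (0, w.2, 0) else (w.2, -w.2 ^ 2 / w.1, w.1), by
      by_cases h : w.1 = 0 <;> simp [h, tracelessDisc]⟩
  left_inv := by
    rintro ⟨⟨a, b, c⟩, h⟩
    simp only [tracelessDisc] at h
    by_cases hc : c = 0
    · subst hc
      have ha : a = 0 := by simpa using h
      simp [ha]
    · have hb : -a ^ 2 / c = b := by
        field_simp
        linear_combination -h
      simp [hc, hb]
  right_inv := by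
    rintro ⟨c, t⟩
    by_cases hc : c = 0 <;> simp [hc]

theorem card_tracelessDisc_eq_zero :
    Nat.card {v : F × F × F // tracelessDisc v = 0} = Nat.card F ^ 2 := by
  rw [Nat.card_congr tracelessDiscZeroEquiv, Nat.card_prod, sq]

theorem card_tracelessDisc_ne_zero [Finite F] :
    Nat.card {v : F × F × F // tracelessDisc v ≠ 0} + Nat.card F ^ 2 = Nat.card F ^ 3 := by
  have := Set.ncard_add_ncard_compl {v : F × F × F | tracelessDisc v = 0}
  simp only [Nat.card_prod] at this
  rw [← card_tracelessDisc_eq_zero, add_comm]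
  refine Eq.trans this ?_
  ring

theorem card_ne_zero_and_tracelessDisc_eq_zero [Finite F] :
    Nat.card {v : F × F × F // v ≠ 0 ∧ tracelessDisc v = 0} + 1 = Nat.card F ^ 2 := by
  have h := Set.ncard_sdiff_singleton_add_one (a := (0 : F × F × F))
    (s := {v : F × F × F | tracelessDisc v = 0}) (by simp [tracelessDisc])
  have hs : {v : F × F × F | v ≠ 0 ∧ tracelessDisc v = 0}
      = {v : F × F × F | tracelessDisc v = 0} \ {0} := by
    ext v
    simp [and_comm]
  rw [← card_tracelessDisc_eq_zero]
  refine Eq.trans ?_ h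
  rw [← hs]
  rfl

end Components

theorem mainTheorem10 (p n : ℕ) (hp : p.Prime) (hodd : Odd p)
    (F : Type*) [Field F] (hF : Nat.card F = p ^ n) :
    (Nat.card (properPowerGraph PGL(2, F)).ConnectedComponent : ℚ) =
      ((p : ℚ) ^ (2 * n + 1) - 1) / ((p : ℚ) - 1) := by
  have : Fact p.Prime := ⟨hp⟩
  have : Finite F := Nat.finite_of_card_ne_zero (by rw [hF]; exact pow_ne_zero n hp.ne_zero)
  have : Fintype F := Fintype.ofFinite F
  have : CharP F p := charP_of_card_eq_prime_pow (f := n) (by rw [← hF, Nat.card_eq_fintype_card])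
  have h2 : (2 : F) ≠ 0 := Ring.two_ne_zero (by
    rw [ringChar.eq F p]
    rintro rfl
    exact absurd hodd (by decide))
  have : Finite PGL(2, F) := Finite.of_surjective _ mk_surjective
  have : Finite (properPowerGraph PGL(2, F)).ConnectedComponent :=
    Finite.of_surjective _ Quot.mk_surjective
  rw [Nat.card_eq_card_range_add_card_range (semisimpleComponent h2) (unipotentComponent h2)
    (semisimpleComponent_ne_unipotentComponent h2)
    (mem_range_semisimpleComponent_or_unipotentComponent h2)]
  have hs := card_range_semisimpleComponent h2
  have hu := card_range_unipotentComponent p h2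
  have h0 := card_tracelessDisc_ne_zero (F := F)
  have h1 := card_ne_zero_and_tracelessDisc_eq_zero (F := F)
  have hq : 1 < Nat.card F := Finite.one_lt_card
  rw [hs, Nat.card_units] at h0
  rw [hu, Nat.card_units, Nat.card_zmod] at h1
  replace h0 := congrArg (Nat.cast : ℕ → ℚ) h0
  replace h1 := congrArg (Nat.cast : ℕ → ℚ) h1
  push_cast [Nat.cast_sub hq.le, Nat.cast_sub hp.one_lt.le] at h0 h1 ⊢
  have hq' : (Nat.card F : ℚ) - 1 ≠ 0 := sub_ne_zero.2 (by exact_mod_cast hq.ne')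
  have hp' : (p : ℚ) - 1 ≠ 0 := sub_ne_zero.2 (by exact_mod_cast hp.one_lt.ne')
  -- Cancel q - 1 in S(q - 1) + q² = q³.
  have hS : (Nat.card (Set.range (semisimpleComponent h2)) : ℚ) = (Nat.card F : ℚ) ^ 2 :=
    mul_right_cancel₀ hq' (by linear_combination h0)
  have hpow : (p : ℚ) ^ (2 * n + 1) = (Nat.card F : ℚ) ^ 2 * p := by
    rw [hF]
    push_cast
    ring
  rw [eq_div_iff hp', hS, hpow]
  linear_combination h1
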